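/- Let $M$ be a compact smooth manifold (without boundary) of dimension $n\ge 4$, and let $G$ be a Lie group (possibly discrete) acting smoothly and effectively on $M$. Suppose that either 1. some nontrivial subgroup of $G$ has a fixed point set in $M$ of dimension $\ge 2$, or 2. some subgroup $H$ of $G$ has a fixed point set in $M$ of dimension $0$ or $1$, and $H$ does not act freely and linearly on a sphere, i.e. there are no $m\ge 0$ and continuous homomorphism $\rho:H\to O(m+1)$ such that $\rho(h)v\ne v$ for all $h\in H\setminus\{1\}$ and all $v\in S^m$. (The dimension of a fixed point set is its covering dimension; when the set is a disjoint union of closed submanifolds this is the largest dimension of a component. The empty set has dimension neither $0$ nor $1$.) Then for every finite $q\ge 2$, the set of smooth Riemannian metrics on $M$ that are not $G$-invariant contains a set that is open and dense, in the $C^q$-topology, in the set of all smooth Riemannian metrics on $M$. Here a metric is $G$-invariant if every element of $G$ acts as an isometry of it. -/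

import Mathlib

open Set Topology Bundle MulAction
open scoped Manifold ContDiff

noncomputable section

namespace GenericMetrics

/-- The smooth Riemannian metrics on an `n`-dimensional smooth manifold `M`. -/
abbrev SmoothMetric (n : ℕ) (M : Type*) [TopologicalSpace M]
    [ChartedSpace (EuclideanSpace ℝ (Fin n)) M] [IsManifold (𝓡 n) ∞ M] : Type _ :=
  ContMDiffRiemannianMetric (𝓡 n) ∞ (EuclideanSpace ℝ (Fin n))
    (fun x : M ↦ TangentSpace (𝓡 n) x)

/-- The `k`-th derivative of a map `f` between normed spaces, as an element of the space of functions
with the topology of uniform convergence on the compact subsets of `s`. -/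
def derivOnCompacts {E F : Type*} [NormedAddCommGroup E] [NormedSpace ℝ E]
    [NormedAddCommGroup F] [NormedSpace ℝ F] (s : Set E) (k : ℕ) (f : E → F) :
    UniformOnFun E (E [×k]→L[ℝ] F) {K : Set E | IsCompact K ∧ K ⊆ s} :=
  UniformOnFun.ofFun _ (iteratedFDeriv ℝ k f)

/-- The coarsest topology on the functions `E → F` for which `f ↦ D^k f` is continuous, uniformly on
the compact subsets of `s`, for all `k ≤ q`. -/
@[reducible] def derivTopology {E F : Type*} [NormedAddCommGroup E] [NormedSpace ℝ E]
    [NormedAddCommGroup F] [NormedSpace ℝ F] (s : Set E) (q : ℕ) : TopologicalSpace (E → F) :=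
  ⨅ k ∈ Finset.range (q + 1), TopologicalSpace.induced (derivOnCompacts s k) inferInstance

section Metrics

variable {n : ℕ} {M : Type*} [TopologicalSpace M]
  [ChartedSpace (EuclideanSpace ℝ (Fin n)) M] [IsManifold (𝓡 n) ∞ M]

/-- The metric `g` read in the chart `φ`: at a point `x` of `φ.target` this is the bilinear form
`(u, v) ↦ g (dφ⁻¹ u, dφ⁻¹ v)`, whose matrix is `(g_{ij}(x))`. -/
def coordRep (g : SmoothMetric n M) (φ : OpenPartialHomeomorph M (EuclideanSpace ℝ (Fin n)))
    (x : EuclideanSpace ℝ (Fin n)) :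
    EuclideanSpace ℝ (Fin n) →L[ℝ] EuclideanSpace ℝ (Fin n) →L[ℝ] ℝ :=
  let A : EuclideanSpace ℝ (Fin n) →L[ℝ] EuclideanSpace ℝ (Fin n) :=
    mfderiv (𝓡 n) (𝓡 n) φ.symm x
  let B : EuclideanSpace ℝ (Fin n) →L[ℝ] EuclideanSpace ℝ (Fin n) →L[ℝ] ℝ :=
    g.inner (φ.symm x)
  B.bilinearComp A A

variable (n M) in
/-- The `C^q`-topology on the set of smooth Riemannian metrics: uniform convergence, on every
compact subset of the domain of every smooth chart, of the coordinate expressions of the metrics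
together with their derivatives of order at most `q`. -/
@[reducible] def cqTopology (q : ℕ) : TopologicalSpace (SmoothMetric n M) :=
  ⨅ φ ∈ IsManifold.maximalAtlas (𝓡 n) ∞ M,
    TopologicalSpace.induced (fun g : SmoothMetric n M ↦ coordRep g φ) (derivTopology φ.target q)

/-- The metric `g` is `G`-invariant: every element of `G` acts on `(M, g)` by an isometry. -/
def IsInvariant (G : Type*) [Group G] [MulAction G M] (g : SmoothMetric n M) : Prop :=
  ∀ (a : G) (x : M) (u v : TangentSpace (𝓡 n) x),
    g.inner (a • x) (mfderiv (𝓡 n) (𝓡 n) (fun y : M ↦ a • y) x u)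
      (mfderiv (𝓡 n) (𝓡 n) (fun y : M ↦ a • y) x v) = g.inner x u v

end Metrics

/-- The covering dimension of `X` is at most `d`: every finite open cover has an open refinement
such that no point lies in more than `d + 1` of its members. -/
def CoveringDimLE (X : Type*) [TopologicalSpace X] (d : ℕ) : Prop :=
  ∀ 𝒰 : Set (Set X), 𝒰.Finite → (∀ U ∈ 𝒰, IsOpen U) → ⋃₀ 𝒰 = univ →
    ∃ 𝒱 : Set (Set X), (∀ V ∈ 𝒱, IsOpen V) ∧ ⋃₀ 𝒱 = univ ∧ (∀ V ∈ 𝒱, ∃ U ∈ 𝒰, V ⊆ U) ∧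
      ∀ x, {V ∈ 𝒱 | x ∈ V}.encard ≤ d + 1

open Classical in
/-- The (Lebesgue covering) dimension of a subset `S` of a topological space, with value `⊥` for
the empty set. For a disjoint union of closed submanifolds in a compact manifold this is the
largest dimension of a component. -/
def dimension {X : Type*} [TopologicalSpace X] (S : Set X) : WithBot ℕ∞ :=
  if S = ∅ then ⊥ else ((⨅ (d : ℕ) (_ : CoveringDimLE S d), (d : ℕ∞) : ℕ∞) : WithBot ℕ∞)

/-- The topological group `H` acts freely and linearly on the unit sphere of some `ℝ^(m+1)`. -/
def ActsFreelyLinearlyOnSphere (H : Type*) [Group H] [TopologicalSpace H] : Prop :=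
  ∃ (m : ℕ) (ρ : H →* (EuclideanSpace ℝ (Fin (m + 1)) ≃ₗᵢ[ℝ] EuclideanSpace ℝ (Fin (m + 1)))),
    Continuous (fun p : H × EuclideanSpace ℝ (Fin (m + 1)) ↦ ρ p.1 p.2) ∧
      ∀ h : H, h ≠ 1 → ∀ v ∈ Metric.sphere (0 : EuclideanSpace ℝ (Fin (m + 1))) 1, ρ h v ≠ v

end GenericMetrics

end

namespace GenericMetrics

open Filter

section Derivatives

variable {E F : Type*} [NormedAddCommGroup E] [NormedSpace ℝ E] [NormedAddCommGroup F]
  [NormedSpace ℝ F] {s : Set E}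

/-! The open dense set is the set of all non-invariant metrics. It is open because invariance is a
family of equations between values `g.inner x u v`, each continuous in `g`
(`continuous_inner_apply`). It is dense because an invariant `g` is a limit of conformal metrics `(1
+ t f) g` with `t → 0`, where `f` takes different values at `x` and `a • x`
(`tendsto_conformalMetric`). This needs only an element `a` that moves some point, so an effective
action of a nontrivial group; either alternative forces `G` to be nontrivial. -/

theorem continuous_eval_derivTopology (q : ℕ) {x : E} (hx : x ∈ s) :
    @Continuous _ _ (derivTopology s q) _ (fun f : E → F ↦ f x) := by
  let := derivTopology (F := F) s q
  have h1 : Continuous (derivOnCompacts (F := F) s 0) :=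
    continuous_iff_le_induced.2 (iInf₂_le 0 (by simp))
  have h2 := (UniformOnFun.uniformContinuous_eval_of_mem (E [×0]→L[ℝ] F)
      {K : Set E | IsCompact K ∧ K ⊆ s} (mem_singleton x)
      ⟨isCompact_singleton, singleton_subset_iff.2 hx⟩).continuous
  exact (continuous_eval_const (F := E [×0]→L[ℝ] F) 0).comp (h2.comp h1)

/-- By linearity the `k`-th derivatives differ by `t m • D^k b`, and `D^k b` is bounded on each
compact subset of `s`. -/
theorem tendsto_derivTopology (q : ℕ) (hs : IsOpen s) {a b : E → F} (ha : ContDiffOn ℝ ∞ a s)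
    (hb : ContDiffOn ℝ ∞ b s) {t : ℕ → ℝ} (ht : Tendsto t atTop (𝓝 0)) :
    Tendsto (fun m ↦ a + t m • b) atTop (@nhds _ (derivTopology s q) a) := by
  simp only [nhds_iInf, nhds_induced, tendsto_iInf, tendsto_comap_iff]
  intro k _
  rw [UniformOnFun.tendsto_iff_tendstoUniformlyOn]
  rintro K ⟨hK, hKs⟩
  have hk : (k : WithTop ℕ∞) ≤ ∞ := by exact_mod_cast le_top
  have hD (m : ℕ) (x) (hx : x ∈ s) : iteratedFDeriv ℝ k (a + t m • b) x =
      iteratedFDeriv ℝ k a x + t m • iteratedFDeriv ℝ k b x := by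
    have hax := (ha.contDiffAt (hs.mem_nhds hx)).of_le hk
    have hbx := (hb.contDiffAt (hs.mem_nhds hx)).of_le hk
    rw [← iteratedFDeriv_const_smul_apply hbx,
      ← iteratedFDeriv_add_apply hax (show ContDiffAt ℝ k (t m • b) x from hbx.const_smul (t m))]
  have hcont : ContinuousOn (iteratedFDeriv ℝ k b) K :=
    ((hb.continuousOn_iteratedFDerivWithin hk hs.uniqueDiffOn).congr
      fun x hx ↦ (iteratedFDerivWithin_of_isOpen k hs hx).symm).mono hKs
  obtain ⟨C, hC⟩ := hK.exists_bound_of_continuousOn hcont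
  have ht0 : Tendsto (fun m ↦ |t m| * C) atTop (𝓝 0) := by
    simpa using ht.abs.mul_const C
  rw [Metric.tendstoUniformlyOn_iff]
  intro ε hε
  filter_upwards [ht0.eventually_lt_const hε] with m hm x hx
  refine lt_of_le_of_lt ?_ hm
  change dist (iteratedFDeriv ℝ k a x) (iteratedFDeriv ℝ k (a + t m • b) x) ≤ _
  rw [hD m x (hKs hx), dist_self_add_right, norm_smul, Real.norm_eq_abs]
  exact mul_le_mul_of_nonneg_left (hC x hx) (abs_nonneg _)

theorem tendsto_derivTopology_smul (q : ℕ) (hs : IsOpen s) {a : E → F} (ha : ContDiffOn ℝ ∞ a s)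
    {f : E → ℝ} (hf : ContDiffOn ℝ ∞ f s) {t : ℕ → ℝ} (ht : Tendsto t atTop (𝓝 0)) :
    Tendsto (fun m x ↦ (1 + t m * f x) • a x) atTop (@nhds _ (derivTopology s q) a) := by
  refine (tendsto_derivTopology q hs ha (hf.smul ha) ht).congr fun m ↦ ?_
  ext1 x
  simp [add_smul, mul_smul]

end Derivatives

section

variable {n : ℕ} {M : Type*} [TopologicalSpace M]
  [ChartedSpace (EuclideanSpace ℝ (Fin n)) M] [IsManifold (𝓡 n) ∞ M]

set_option synthInstance.maxHeartbeats 200000 in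
/-- The metric `ρ g` in the conformal class of `g`, for a smooth function `ρ ≥ 1`. -/
noncomputable def conformalMetric (g : SmoothMetric n M) (ρ : M → ℝ)
    (hρ : ContMDiff (𝓡 n) 𝓘(ℝ, ℝ) ∞ ρ) (h1 : ∀ x, 1 ≤ ρ x) : SmoothMetric n M where
  inner x := ρ x • g.inner x
  symm x v w := by
    change ρ x * g.inner x v w = ρ x * g.inner x w v
    rw [g.symm]
  pos x v hv := mul_pos (zero_lt_one.trans_le (h1 x)) (g.pos x v hv)
  isVonNBounded x := by
    -- As `ρ ≥ 1`, the unit ball of `ρ g` lies in that of `g`.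
    refine (g.isVonNBounded x).subset fun v hv ↦ ?_
    change ρ x * g.inner x v v < 1 at hv
    change g.inner x v v < 1
    have h0 : 0 ≤ g.inner x v v := by
      by_cases h : v = 0
      · simp [h]
      · exact (g.pos x v h).le
    nlinarith [h1 x]
  contMDiff := hρ.smul_section g.contMDiff

theorem contDiffOn_coordRep (g : SmoothMetric n M)
    {φ : OpenPartialHomeomorph M (EuclideanSpace ℝ (Fin n))}
    (hφ : φ ∈ IsManifold.maximalAtlas (𝓡 n) ∞ M) :
    ContDiffOn ℝ ∞ (coordRep g φ) φ.target := by
  have hsymm : ContMDiffOn (𝓡 n) (𝓡 n) ∞ φ.symm φ.target :=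
    contMDiffOn_symm_of_mem_maximalAtlas hφ
  -- Constant vector fields push forward to smooth fields along `φ.symm`; pairing two of them by `g`
  -- gives the coefficients.
  have hpush (u : EuclideanSpace ℝ (Fin n)) :
      ContMDiffOn (𝓡 n) ((𝓡 n).prod (𝓡 n)) ∞
        (fun x ↦ (TotalSpace.mk' (EuclideanSpace ℝ (Fin n)) (φ.symm x)
          (mfderiv (𝓡 n) (𝓡 n) φ.symm x u) : TangentBundle (𝓡 n) M)) φ.target := by
    have hT := hsymm.contMDiffOn_tangentMapWithin (m := ∞) (by simp)
      φ.open_target.uniqueMDiffOn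
    have hu : ContMDiffOn (𝓡 n) ((𝓡 n).prod (𝓡 n)) ∞
        (fun x ↦ (TotalSpace.mk' (EuclideanSpace ℝ (Fin n)) x u :
          TangentBundle (𝓡 n) (EuclideanSpace ℝ (Fin n)))) φ.target := fun x _ ↦
      contMDiffWithinAt_vectorSpace_iff_contDiffWithinAt.2 contDiffWithinAt_const
    refine (hT.comp hu fun x hx ↦ hx).congr fun x hx ↦ ?_
    simp only [Function.comp_apply, tangentMapWithin,
      mfderivWithin_of_isOpen φ.open_target hx]
  rw [contDiffOn_clm_apply]
  intro u
  rw [contDiffOn_clm_apply]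
  intro v x hx
  have hg : ContMDiffWithinAt (𝓡 n) ((𝓡 n).prod 𝓘(ℝ, EuclideanSpace ℝ (Fin n) →L[ℝ]
      EuclideanSpace ℝ (Fin n) →L[ℝ] ℝ)) ∞
      (fun x ↦ TotalSpace.mk' (EuclideanSpace ℝ (Fin n) →L[ℝ] EuclideanSpace ℝ (Fin n) →L[ℝ] ℝ)
        (E := fun x : M ↦ (TangentSpace (𝓡 n) x →L[ℝ] TangentSpace (𝓡 n) x →L[ℝ] ℝ))
        (φ.symm x) (g.inner (φ.symm x))) φ.target x :=
    (g.contMDiff _).comp_contMDiffWithinAt x (hsymm x hx)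
  have h := ContMDiffWithinAt.clm_bundle_apply₂ (F₁ := EuclideanSpace ℝ (Fin n))
    (F₂ := EuclideanSpace ℝ (Fin n)) (F₃ := ℝ) (E₁ := fun x : M ↦ TangentSpace (𝓡 n) x)
    (E₂ := fun x : M ↦ TangentSpace (𝓡 n) x) (E₃ := Bundle.Trivial M ℝ)
    hg (hpush u x hx) (hpush v x hx)
  rw [contMDiffWithinAt_totalSpace] at h
  exact h.2.contDiffWithinAt

/-- In a chart at `x` this is evaluation of `coordRep` at `φ x` on the vectors `dφ u`, `dφ v`, since
`dφ⁻¹ ∘ dφ = id`. -/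
theorem continuous_inner_apply (q : ℕ) (x : M) (u v : TangentSpace (𝓡 n) x) :
    @Continuous _ _ (cqTopology n M q) _ (fun g : SmoothMetric n M ↦ g.inner x u v) := by
  let := cqTopology n M q
  set φ := chartAt (EuclideanSpace ℝ (Fin n)) x
  have hφ : φ ∈ IsManifold.maximalAtlas (𝓡 n) ∞ M := IsManifold.chart_mem_maximalAtlas x
  have hx : x ∈ φ.source := mem_chart_source _ x
  have hmd : φ.MDifferentiable (𝓡 n) (𝓡 n) := mdifferentiable_chart x
  let : TopologicalSpace (EuclideanSpace ℝ (Fin n) → EuclideanSpace ℝ (Fin n) →L[ℝ]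
    EuclideanSpace ℝ (Fin n) →L[ℝ] ℝ) := derivTopology φ.target q
  have h1 : Continuous (fun g : SmoothMetric n M ↦ coordRep g φ) :=
    continuous_iff_le_induced.2 (iInf₂_le φ hφ)
  have h2 : Continuous fun g : SmoothMetric n M ↦ coordRep g φ (φ x) :=
    (continuous_eval_derivTopology q (φ.map_source hx)).comp h1
  let u' : EuclideanSpace ℝ (Fin n) := mfderiv (𝓡 n) (𝓡 n) φ x u
  let v' : EuclideanSpace ℝ (Fin n) := mfderiv (𝓡 n) (𝓡 n) φ x v
  have h3 : Continuous fun g : SmoothMetric n M ↦ coordRep g φ (φ x) u' v' :=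
    (h2.clm_apply continuous_const).clm_apply continuous_const
  convert h3 using 2 with g
  have hcomp (w : TangentSpace (𝓡 n) x) :
      mfderiv (𝓡 n) (𝓡 n) φ.symm (φ x) (mfderiv (𝓡 n) (𝓡 n) φ x w) = w :=
    DFunLike.congr_fun (hmd.symm_comp_deriv hx) w
  change _ = g.inner (φ.symm (φ x)) (mfderiv (𝓡 n) (𝓡 n) φ.symm (φ x) u')
    (mfderiv (𝓡 n) (𝓡 n) φ.symm (φ x) v')
  rw [hcomp, hcomp, φ.left_inv hx]

theorem isClosed_setOf_isInvariant (G : Type*) [Group G] [MulAction G M] (q : ℕ) :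
    IsClosed[cqTopology n M q] {g : SmoothMetric n M | IsInvariant G g} := by
  let := cqTopology n M q
  simp only [IsInvariant, ofPred_forall]
  exact isClosed_iInter fun a ↦ isClosed_iInter fun x ↦ isClosed_iInter fun u ↦
    isClosed_iInter fun v ↦ isClosed_eq (continuous_inner_apply q _ _ _)
      (continuous_inner_apply q _ _ _)

theorem tendsto_conformalMetric (q : ℕ) (g : SmoothMetric n M) {f : M → ℝ}
    (hf : ContMDiff (𝓡 n) 𝓘(ℝ, ℝ) ∞ f) {t : ℕ → ℝ} (ht : Tendsto t atTop (𝓝 0))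
    (hρ : ∀ m, ContMDiff (𝓡 n) 𝓘(ℝ, ℝ) ∞ fun x ↦ 1 + t m * f x)
    (h1 : ∀ m x, 1 ≤ 1 + t m * f x) :
    Tendsto (fun m ↦ conformalMetric g _ (hρ m) (h1 m)) atTop
      (@nhds _ (cqTopology n M q) g) := by
  rw [nhds_iInf, tendsto_iInf]
  intro φ
  rw [nhds_iInf, tendsto_iInf]
  intro hφ
  rw [@nhds_induced _ _ (derivTopology φ.target q), tendsto_comap_iff]
  exact tendsto_derivTopology_smul q φ.open_target (contDiffOn_coordRep g hφ)
    (hf.comp_contMDiffOn (contMDiffOn_symm_of_mem_maximalAtlas hφ)).contDiffOn ht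

theorem dense_setOf_not_isInvariant [T2Space M] [CompactSpace M] (hn : 0 < n) (G : Type*) [Group G]
    [MulAction G M] [FaithfulSMul G M] [Nontrivial G] (q : ℕ) :
    @Dense _ (cqTopology n M q) {g : SmoothMetric n M | ¬ IsInvariant G g} := by
  let := cqTopology n M q
  intro g
  by_cases hg : IsInvariant G g
  swap
  · exact subset_closure hg
  obtain ⟨a, ha⟩ := exists_ne (1 : G)
  obtain ⟨x, hx⟩ : ∃ x : M, a • x ≠ x := by
    by_contra! h
    exact ha (FaithfulSMul.eq_of_smul_eq_smul fun y : M ↦ by rw [h y, one_smul])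
  obtain ⟨f, hf0, hf1, hf⟩ := exists_contMDiffMap_zero_one_of_isClosed (n := ⊤) (𝓡 n)
    (isClosed_singleton (x := a • x)) (isClosed_singleton (x := x))
    (by simpa using hx)
  have hρ (m : ℕ) : ContMDiff (𝓡 n) 𝓘(ℝ, ℝ) ∞ fun x ↦ 1 + 1 / ((m : ℝ) + 1) * f x :=
    contMDiff_const.add (contMDiff_const.mul f.contMDiff)
  have h1 (m : ℕ) (x : M) : 1 ≤ 1 + 1 / ((m : ℝ) + 1) * f x :=
    le_add_of_nonneg_right (mul_nonneg (by positivity) (hf x).1)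
  refine mem_closure_of_tendsto
    (tendsto_conformalMetric q g f.contMDiff tendsto_one_div_add_atTop_nhds_zero_nat hρ h1)
    (Eventually.of_forall fun m hinv ↦ ?_)
  have : Nonempty (Fin n) := ⟨⟨0, hn⟩⟩
  obtain ⟨u, hu⟩ := exists_ne (0 : EuclideanSpace ℝ (Fin n))
  change TangentSpace (𝓡 n) x at u
  have hpos := g.pos x u hu
  -- With `f (a • x) = 0`, `f x = 1` and `g` invariant, this reads `g(u, u) = (1 + 1 / (m + 1)) g(u,
  -- u)`, absurd for `u ≠ 0`.
  have h : (1 + 1 / ((m : ℝ) + 1) * f (a • x)) * g.inner (a • x)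
      (mfderiv (𝓡 n) (𝓡 n) (fun y : M ↦ a • y) x u)
      (mfderiv (𝓡 n) (𝓡 n) (fun y : M ↦ a • y) x u) =
      (1 + 1 / ((m : ℝ) + 1) * f x) * g.inner x u u := hinv a x u u
  rw [hg a x u u, hf0 rfl, hf1 rfl] at h
  have hm : 0 < 1 / ((m : ℝ) + 1) := by positivity
  simp only [Pi.zero_apply, Pi.one_apply, mul_zero, mul_one, add_zero, one_mul] at h
  nlinarith [mul_pos hm hpos]

end

/-- Freeness is vacuous, so the trivial representation on `ℝ^1` serves. Hence the second alternative
excludes a trivial `G`. -/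
theorem actsFreelyLinearlyOnSphere_of_subsingleton (H : Type*) [Group H] [TopologicalSpace H]
    [Subsingleton H] : ActsFreelyLinearlyOnSphere H :=
  ⟨0, 1, continuous_snd, fun h hh ↦ (hh (Subsingleton.elim h 1)).elim⟩

end GenericMetrics

theorem corollaryB (n : ℕ) (hn : 4 ≤ n)
    (M : Type*) [TopologicalSpace M] [T2Space M] [CompactSpace M]
    [ChartedSpace (EuclideanSpace ℝ (Fin n)) M] [IsManifold (𝓡 n) ∞ M]
    (d : ℕ) (G : Type*) [Group G] [TopologicalSpace G]
    [ChartedSpace (EuclideanSpace ℝ (Fin d)) G] [LieGroup (𝓡 d) ∞ G]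
    [MulAction G M] [ContMDiffSMul (𝓡 d) (𝓡 n) ∞ G M] [FaithfulSMul G M]
    (hG : (∃ H : Subgroup G, H ≠ ⊥ ∧ 2 ≤ GenericMetrics.dimension (fixedPoints H M)) ∨
      (∃ H : Subgroup G, (GenericMetrics.dimension (fixedPoints H M) = 0 ∨
          GenericMetrics.dimension (fixedPoints H M) = 1) ∧
        ¬ GenericMetrics.ActsFreelyLinearlyOnSphere H))
    (q : ℕ) (hq : 2 ≤ q) :
    ∃ 𝒰 : Set (GenericMetrics.SmoothMetric n M),
      IsOpen[GenericMetrics.cqTopology n M q] 𝒰 ∧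
      @Dense (GenericMetrics.SmoothMetric n M) (GenericMetrics.cqTopology n M q) 𝒰 ∧
      ∀ g ∈ 𝒰, ¬ GenericMetrics.IsInvariant G g := by
  have : Nontrivial G := by
    by_contra hG'
    have := not_nontrivial_iff_subsingleton.1 hG'
    obtain ⟨H, hH, -⟩ | ⟨H, -, hH⟩ := hG
    · exact hH (Subsingleton.elim H ⊥)
    · exact hH (GenericMetrics.actsFreelyLinearlyOnSphere_of_subsingleton H)
  exact ⟨{g | ¬ GenericMetrics.IsInvariant G g},
    @IsClosed.isOpen_compl _ (GenericMetrics.cqTopology n M q) _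
      (GenericMetrics.isClosed_setOf_isInvariant G q),
    GenericMetrics.dense_setOf_not_isInvariant (by lia) G q, fun g hg ↦ hg⟩
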